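/- Let $\Gamma=(V,E)$ be a finite oriented graph (a directed graph $E\subseteq V\times V$ such that $(a,b)\in E$ implies $(b,a)\notin E$; $\mathrm o(e)$ and $\mathrm t(e)$ are the origin and terminus of $e$, and $E_v^{\mathrm o}$, $E_v^{\mathrm t}$ the sets of edges with origin, resp. terminus, $v$). To every edge $e$ assign a nonzero finite-dimensional complex (Hilbert) space $\mathcal V_e$, and to every vertex $v$ a complex (Hilbert) space $\mathcal H_v$; the inner products play no role and tensor products are algebraic. A collection of PEPS tensors is a family of tensors $A_v\in\bigotimes_{o\in E_v^{\mathrm o}}\mathcal V_o\otimes\mathcal H_v\otimes\bigotimes_{t\in E_v^{\mathrm t}}\mathcal V_t^*$, viewed as linear maps $$A_v:\bigotimes_{o\in E_v^{\mathrm o}}\mathcal V_o^*\otimes\bigotimes_{t\in E_v^{\mathrm t}}\mathcal V_t\longrightarrow\mathcal H_v .$$ The PEPS $|\Psi_\Gamma(A)\rangle:=\operatorname{tr}_E\bigotimes_{v\in V}A_v\in\bigotimes_{v\in V}\mathcal H_v$ is their contraction over all edges. For a (not necessarily induced) subgraph $\Lambda=(V',E')\subseteq\Gamma$, let $\partial_{\mathrm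 o}\Lambda$, $\partial_{\mathrm t}\Lambda$, $\partial_{\mathrm i}\Lambda$ be the sets of edges in $E\setminus E'$ with, respectively, only the origin, only the terminus, or both endpoints in $V'$. We call $\Lambda$ an injective region if the blocked tensor $\mathbb T_\Lambda(A):=\operatorname{tr}_{E'}\bigotimes_{v\in V'}A_v$ is injective as a linear map $$\bigotimes_{e\in\partial_{\mathrm o}\Lambda}\mathcal V_e^*\otimes\bigotimes_{f\in\partial_{\mathrm i}\Lambda}(\mathcal V_f^*\otimes\mathcal V_f)\otimes\bigotimes_{d\in\partial_{\mathrm t}\Lambda}\mathcal V_d\longrightarrow\bigotimes_{v\in V'}\mathcal H_v .$$ Suppose that 1. (normality) every vertex of $\Gamma$ lies in some injective region; 2. ($\Gamma$ is big enough) for every edge $e$ there are two injective regions $\Lambda^{\mathrm o},\Lambda^{\mathrm t}$ with disjoint vertex sets such that $\mathrm o(e)$ is a vertex of $\Lambda^{\mathrm o}$ and $\mathrm t(e)$ is a vertex of $\Lambda^{\mathrm t}$; 3. (local onsite symmetry) $G$ is a group with linear representations $U_v$ on $\mathcal H_v$, $v\in V$, such that $U_v(g)|\Psi_\Gamma(A)\rangle=|\Psi_\Gamma(A)\rangle$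 for all $g\in G$ and $v\in V$, where $U_v(g)$ acts on the factor $\mathcal H_v$ only. Then every PEPS tensor transforms trivially under the symmetry: $U_v(g)\circ A_v=A_v$ for all $g\in G$ and $v\in V$. -/

import Mathlib

open scoped TensorProduct

/-- An oriented graph on the vertex set `V`: a directed graph (a set of ordered pairs of vertices)
such that the reverse of an edge is never an edge. In particular there are no loops and no double
edges. -/
structure OrientedGraph (V : Type*) extends Digraph V where
  asymm : ∀ ⦃a b : V⦄, Adj a b → ¬ Adj b a

namespace OrientedGraph

section Graph

variable {V : Type*} (Γ : OrientedGraph V)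

/-- The edges of an oriented graph: the pairs `(o(e), t(e))`. -/
abbrev Edge : Type _ := {p : V × V // Γ.Adj p.1 p.2}

variable {Γ}

/-- The origin `o(e)` of an edge. -/
def Edge.origin (e : Γ.Edge) : V := e.1.1

/-- The terminus `t(e)` of an edge. -/
def Edge.terminus (e : Γ.Edge) : V := e.1.2

variable (Γ)

/-- The edges with origin `v` (outgoing edges). -/
def outEdges (v : V) : Set Γ.Edge := {e | e.origin = v}

/-- The edges with terminus `v` (incoming edges). -/
def inEdges (v : V) : Set Γ.Edge := {e | e.terminus = v}

/-- A (not necessarily induced) subgraph: a set of vertices and a set of edges such that both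
endpoints of each chosen edge are chosen vertices. -/
structure Subgraph where
  verts : Set V
  edges : Set Γ.Edge
  origin_mem : ∀ e ∈ edges, e.origin ∈ verts
  terminus_mem : ∀ e ∈ edges, e.terminus ∈ verts

variable {Γ}

namespace Subgraph

/-- Two subgraphs are disjoint if their vertex sets are disjoint. -/
def IsDisjoint (Λ₁ Λ₂ : Γ.Subgraph) : Prop := Disjoint Λ₁.verts Λ₂.verts

/-- The terminal boundary `∂ₜΛ`: edges outside `Λ` entering the vertex set of `Λ`. -/
def terminalBoundary (Λ : Γ.Subgraph) : Set Γ.Edge :=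
  {e | e ∉ Λ.edges ∧ e.origin ∉ Λ.verts ∧ e.terminus ∈ Λ.verts}

/-- The original boundary `∂ₒΛ`: edges outside `Λ` leaving the vertex set of `Λ`. -/
def originalBoundary (Λ : Γ.Subgraph) : Set Γ.Edge :=
  {e | e ∉ Λ.edges ∧ e.origin ∈ Λ.verts ∧ e.terminus ∉ Λ.verts}

/-- The internal boundary `∂ᵢΛ`: edges outside `Λ` with both endpoints in `Λ`. -/
def internalBoundary (Λ : Γ.Subgraph) : Set Γ.Edge :=
  {e | e ∉ Λ.edges ∧ e.origin ∈ Λ.verts ∧ e.terminus ∈ Λ.verts}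

/-- The edges whose origin leg remains open after blocking along `Λ`. -/
def openOut (Λ : Γ.Subgraph) : Set Γ.Edge := Λ.originalBoundary ∪ Λ.internalBoundary

/-- The edges whose terminus leg remains open after blocking along `Λ`. -/
def openIn (Λ : Γ.Subgraph) : Set Γ.Edge := Λ.terminalBoundary ∪ Λ.internalBoundary

end Subgraph

end Graph

end OrientedGraph

noncomputable section

/-- The linear map out of `(⨂ᵢ sᵢ) ⊗ (⨂ⱼ tⱼ)` given by a function `F` of pure tensors that is
multilinear in each of its two families of arguments. -/
def PiTensorProduct.biLift {ι κ : Type*} {s : ι → Type*} {t : κ → Type*} {M : Type*}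
    [∀ i, AddCommGroup (s i)] [∀ i, Module ℂ (s i)]
    [∀ j, AddCommGroup (t j)] [∀ j, Module ℂ (t j)] [AddCommGroup M] [Module ℂ M]
    (F : (∀ i, s i) → MultilinearMap ℂ t M)
    (hadd : ∀ [DecidableEq ι] (φ : ∀ i, s i) (i : ι) (a b : s i) (x : ∀ j, t j),
      F (Function.update φ i (a + b)) x = F (Function.update φ i a) x + F (Function.update φ i b) x)
    (hsmul : ∀ [DecidableEq ι] (φ : ∀ i, s i) (i : ι) (c : ℂ) (a : s i) (x : ∀ j, t j),
      F (Function.update φ i (c • a)) x = c • F (Function.update φ i a) x) :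
    ((⨂[ℂ] i, s i) ⊗[ℂ] (⨂[ℂ] j, t j)) →ₗ[ℂ] M :=
  TensorProduct.lift (PiTensorProduct.lift
    { toFun := fun φ => PiTensorProduct.lift (F φ)
      map_update_add' := by
        intro _ φ i a b
        ext x
        simpa using hadd φ i a b x
      map_update_smul' := by
        intro _ φ i c a
        ext x
        simpa using hsmul φ i c a x })

theorem PiTensorProduct.biLift_tprod {ι κ : Type*} {s : ι → Type*} {t : κ → Type*} {M : Type*}
    [∀ i, AddCommGroup (s i)] [∀ i, Module ℂ (s i)]
    [∀ j, AddCommGroup (t j)] [∀ j, Module ℂ (t j)] [AddCommGroup M] [Module ℂ M]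
    (F : (∀ i, s i) → MultilinearMap ℂ t M) (hadd) (hsmul) (φ : ∀ i, s i) (x : ∀ j, t j) :
    PiTensorProduct.biLift F hadd hsmul
      (PiTensorProduct.tprod ℂ φ ⊗ₜ[ℂ] PiTensorProduct.tprod ℂ x) = F φ x := by
  simp [PiTensorProduct.biLift]

variable {V : Type*} {Γ : OrientedGraph V}

/-- A collection of PEPS tensors on `Γ` with virtual spaces `𝒱 e` and physical spaces `H v`.
A tensor in `⨂_{o outgoing} 𝒱 o ⊗ H v ⊗ ⨂_{t incoming} (𝒱 t)*` is given as the corresponding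
linear map from virtual to physical spaces. -/
abbrev PEPS (Γ : OrientedGraph V) (𝒱 : Γ.Edge → Type*) (H : V → Type*)
    [∀ e, AddCommGroup (𝒱 e)] [∀ e, Module ℂ (𝒱 e)]
    [∀ v, AddCommGroup (H v)] [∀ v, Module ℂ (H v)] : Type _ :=
  ∀ v : V, ((⨂[ℂ] e : Γ.outEdges v, Module.Dual ℂ (𝒱 e)) ⊗[ℂ] (⨂[ℂ] e : Γ.inEdges v, 𝒱 e))
    →ₗ[ℂ] H v

namespace PEPS

variable {𝒱 : Γ.Edge → Type*} {H : V → Type*}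
  [∀ e, AddCommGroup (𝒱 e)] [∀ e, Module ℂ (𝒱 e)]
  [∀ v, AddCommGroup (H v)] [∀ v, Module ℂ (H v)]

/-- The tensor `A_v` evaluated at a functional `φ e` on each outgoing leg and a vector `x e` on each
incoming leg. -/
def eval (A : PEPS Γ 𝒱 H) (φ : ∀ e, Module.Dual ℂ (𝒱 e)) (x : ∀ e, 𝒱 e) (v : V) : H v :=
  A v (PiTensorProduct.tprod ℂ (fun e : Γ.outEdges v => φ e) ⊗ₜ[ℂ]
    PiTensorProduct.tprod ℂ (fun e : Γ.inEdges v => x e))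

theorem eval_congr (A : PEPS Γ 𝒱 H) {φ φ' : ∀ e, Module.Dual ℂ (𝒱 e)} {x x' : ∀ e, 𝒱 e} {v : V}
    (h : ∀ e, e.origin = v → φ e = φ' e) (h' : ∀ e, e.terminus = v → x e = x' e) :
    A.eval φ x v = A.eval φ' x' v := by
  have h1 : (fun e : Γ.outEdges v => φ e) = fun e : Γ.outEdges v => φ' e :=
    funext fun e => h e.1 e.2
  have h2 : (fun e : Γ.inEdges v => x e) = fun e : Γ.inEdges v => x' e :=
    funext fun e => h' e.1 e.2
  unfold eval
  rw [h1, h2]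

open Classical in
theorem tprod_eval_update_out (A : PEPS Γ 𝒱 H) (W : Set V) (φ : ∀ e, Module.Dual ℂ (𝒱 e))
    (x : ∀ e, 𝒱 e) (e : Γ.Edge) (he : e.origin ∈ W) :
    ∃ f : Module.Dual ℂ (𝒱 e) →ₗ[ℂ] ⨂[ℂ] v : W, H v, ∀ a,
      PiTensorProduct.tprod ℂ (fun v : W => A.eval (Function.update φ e a) x v) = f a := by
  let v₀ : W := ⟨e.origin, he⟩
  let e₀ : Γ.outEdges v₀ := ⟨e, rfl⟩
  let L : Module.Dual ℂ (𝒱 e) →ₗ[ℂ] H v₀ :=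
    (A v₀) ∘ₗ ((TensorProduct.mk ℂ _ _).flip
      (PiTensorProduct.tprod ℂ (fun e : Γ.inEdges v₀ => x e))) ∘ₗ
      ((PiTensorProduct.tprod ℂ).toLinearMap (fun e : Γ.outEdges v₀ => φ e) e₀)
  refine ⟨((PiTensorProduct.tprod ℂ).toLinearMap (fun v : W => A.eval φ x v) v₀) ∘ₗ L, ?_⟩
  intro a
  simp only [LinearMap.comp_apply, MultilinearMap.toLinearMap_apply]
  congr 1
  funext v
  by_cases hv : v = v₀
  · subst hv
    rw [Function.update_self]
    simp only [L, eval, LinearMap.comp_apply, MultilinearMap.toLinearMap_apply,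
      LinearMap.flip_apply, TensorProduct.mk_apply]
    congr 3
    funext e'
    by_cases h : e' = e₀
    · subst h
      simp [e₀]
    · have h' : (e' : Γ.Edge) ≠ e := fun hh => h (Subtype.ext hh)
      rw [Function.update_of_ne h, Function.update_of_ne h']
  · rw [Function.update_of_ne hv]
    refine A.eval_congr (fun e' he' => ?_) (fun _ _ => rfl)
    rw [Function.update_of_ne]
    rintro rfl
    exact hv (Subtype.ext he'.symm)

open Classical in
theorem tprod_eval_update_in (A : PEPS Γ 𝒱 H) (W : Set V) (φ : ∀ e, Module.Dual ℂ (𝒱 e))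
    (x : ∀ e, 𝒱 e) (e : Γ.Edge) (he : e.terminus ∈ W) :
    ∃ f : 𝒱 e →ₗ[ℂ] ⨂[ℂ] v : W, H v, ∀ a,
      PiTensorProduct.tprod ℂ (fun v : W => A.eval φ (Function.update x e a) v) = f a := by
  let v₀ : W := ⟨e.terminus, he⟩
  let e₀ : Γ.inEdges v₀ := ⟨e, rfl⟩
  let L : 𝒱 e →ₗ[ℂ] H v₀ :=
    (A v₀) ∘ₗ ((TensorProduct.mk ℂ _ _)
      (PiTensorProduct.tprod ℂ (fun e : Γ.outEdges v₀ => φ e))) ∘ₗ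
      ((PiTensorProduct.tprod ℂ).toLinearMap (fun e : Γ.inEdges v₀ => x e) e₀)
  refine ⟨((PiTensorProduct.tprod ℂ).toLinearMap (fun v : W => A.eval φ x v) v₀) ∘ₗ L, ?_⟩
  intro a
  simp only [LinearMap.comp_apply, MultilinearMap.toLinearMap_apply]
  congr 1
  funext v
  by_cases hv : v = v₀
  · subst hv
    rw [Function.update_self]
    simp only [L, eval, LinearMap.comp_apply, MultilinearMap.toLinearMap_apply,
      TensorProduct.mk_apply]
    congr 3
    funext e'
    by_cases h : e' = e₀
    · subst h
      simp [e₀]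
    · have h' : (e' : Γ.Edge) ≠ e := fun hh => h (Subtype.ext hh)
      rw [Function.update_of_ne h, Function.update_of_ne h']
  · rw [Function.update_of_ne hv]
    refine A.eval_congr (fun _ _ => rfl) (fun e' he' => ?_)
    rw [Function.update_of_ne]
    rintro rfl
    exact hv (Subtype.ext he'.symm)

variable [∀ e, FiniteDimensional ℂ (𝒱 e)]

variable (𝒱) in
/-- The labels of a basis of `𝒱 e`, one for each edge `e` in `S`. The contraction over the edges
in `S` is the sum over all such labelings of the insertion of the dual basis vector at the origin
and the basis vector at the terminus of each edge; it does not depend on the basis. -/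
abbrev Labeling (S : Set Γ.Edge) : Type _ :=
  ∀ e : S, Fin (Module.finrank ℂ (𝒱 e))

open Classical in
/-- Functionals on the outgoing legs of `Λ`: dual basis vectors on the edges of `Λ`, and `φ` on the
open legs. (The value `0` is only taken at edges whose origin is not in `Λ`.) -/
def outLegs (Λ : Γ.Subgraph) (i : Labeling 𝒱 Λ.edges)
    (φ : ∀ e : Λ.openOut, Module.Dual ℂ (𝒱 e)) (e : Γ.Edge) : Module.Dual ℂ (𝒱 e) :=
  if h : e ∈ Λ.edges then (Module.finBasis ℂ (𝒱 e)).coord (i ⟨e, h⟩)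
  else if h : e ∈ Λ.openOut then φ ⟨e, h⟩ else 0

open Classical in
/-- Vectors on the incoming legs of `Λ`: basis vectors on the edges of `Λ`, and `x` on the
open legs. (The value `0` is only taken at edges whose terminus is not in `Λ`.) -/
def inLegs (Λ : Γ.Subgraph) (i : Labeling 𝒱 Λ.edges)
    (x : ∀ e : Λ.openIn, 𝒱 e) (e : Γ.Edge) : 𝒱 e :=
  if h : e ∈ Λ.edges then Module.finBasis ℂ (𝒱 e) (i ⟨e, h⟩)
  else if h : e ∈ Λ.openIn then x ⟨e, h⟩ else 0

theorem outLegs_update [DecidableEq Γ.Edge] (Λ : Γ.Subgraph) [DecidableEq Λ.openOut]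
    (i : Labeling 𝒱 Λ.edges)
    (φ : ∀ e : Λ.openOut, Module.Dual ℂ (𝒱 e)) (e : Λ.openOut) (a : Module.Dual ℂ (𝒱 e)) :
    outLegs Λ i (Function.update φ e a) = Function.update (outLegs Λ i φ) e.1 a := by
  funext e'
  by_cases h : e' = e.1
  · subst h
    have h1 : e.1 ∉ Λ.edges := by
      rcases e.2 with h | h <;> exact h.1
    simp [outLegs, h1, e.2]
  · rw [Function.update_of_ne h]
    unfold outLegs
    split_ifs with h1 h2
    · rfl
    · rw [Function.update_of_ne]
      exact fun hh => h (congrArg Subtype.val hh)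
    · rfl

theorem inLegs_update [DecidableEq Γ.Edge] (Λ : Γ.Subgraph) [DecidableEq Λ.openIn]
    (i : Labeling 𝒱 Λ.edges)
    (x : ∀ e : Λ.openIn, 𝒱 e) (e : Λ.openIn) (a : 𝒱 e) :
    inLegs Λ i (Function.update x e a) = Function.update (inLegs Λ i x) e.1 a := by
  funext e'
  by_cases h : e' = e.1
  · subst h
    have h1 : e.1 ∉ Λ.edges := by
      rcases e.2 with h | h <;> exact h.1
    simp [inLegs, h1, e.2]
  · rw [Function.update_of_ne h]
    unfold inLegs
    split_ifs with h1 h2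
    · rfl
    · rw [Function.update_of_ne]
      exact fun hh => h (congrArg Subtype.val hh)
    · rfl

theorem openOut_origin_mem {Λ : Γ.Subgraph} (e : Λ.openOut) : e.1.origin ∈ Λ.verts := by
  rcases e.2 with h | h
  · exact h.2.1
  · exact h.2.1

theorem openIn_terminus_mem {Λ : Γ.Subgraph} (e : Λ.openIn) : e.1.terminus ∈ Λ.verts := by
  rcases e.2 with h | h
  · exact h.2.2
  · exact h.2.2

open Classical in
/-- The summand of the blocked tensor along `Λ` for a fixed labeling of the edges of `Λ`. -/
def blockedSummand (A : PEPS Γ 𝒱 H) (Λ : Γ.Subgraph) (i : Labeling 𝒱 Λ.edges) :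
    ((⨂[ℂ] e : Λ.openOut, Module.Dual ℂ (𝒱 e)) ⊗[ℂ] (⨂[ℂ] e : Λ.openIn, 𝒱 e))
      →ₗ[ℂ] ⨂[ℂ] v : Λ.verts, H v :=
  PiTensorProduct.biLift
    (fun φ =>
      { toFun := fun x => PiTensorProduct.tprod ℂ
          (fun v : Λ.verts => A.eval (outLegs Λ i φ) (inLegs Λ i x) v)
        map_update_add' := by
          intro _ x e a b
          obtain ⟨f, hf⟩ := A.tprod_eval_update_in Λ.verts (outLegs Λ i φ) (inLegs Λ i x) e
            (openIn_terminus_mem e)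
          simp only [inLegs_update, hf, map_add]
        map_update_smul' := by
          intro _ x e c a
          obtain ⟨f, hf⟩ := A.tprod_eval_update_in Λ.verts (outLegs Λ i φ) (inLegs Λ i x) e
            (openIn_terminus_mem e)
          simp only [inLegs_update, hf, map_smul] })
    (by
      intro _ φ e a b x
      obtain ⟨f, hf⟩ := A.tprod_eval_update_out Λ.verts (outLegs Λ i φ) (inLegs Λ i x) e
        (openOut_origin_mem e)
      simp only [MultilinearMap.coe_mk, outLegs_update, hf, map_add])
    (by
      intro _ φ e c a x
      obtain ⟨f, hf⟩ := A.tprod_eval_update_out Λ.verts (outLegs Λ i φ) (inLegs Λ i x) e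
        (openOut_origin_mem e)
      simp only [MultilinearMap.coe_mk, outLegs_update, hf, map_smul])

open Classical in
/-- The blocked tensor `𝕋_Λ(A)`: the tensors at the vertices of `Λ`, contracted over the edges of
`Λ`, as a linear map from the virtual spaces on the boundary of `Λ` to the physical spaces of `Λ`.
Its domain is `⨂_{∂ₒΛ} 𝒱* ⊗ ⨂_{∂ᵢΛ} (𝒱* ⊗ 𝒱) ⊗ ⨂_{∂ₜΛ} 𝒱` with the factors `𝒱*` collected on the
left and the factors `𝒱` on the right. -/
def blockedTensor [Finite V] (A : PEPS Γ 𝒱 H) (Λ : Γ.Subgraph) :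
    ((⨂[ℂ] e : Λ.openOut, Module.Dual ℂ (𝒱 e)) ⊗[ℂ] (⨂[ℂ] e : Λ.openIn, 𝒱 e))
      →ₗ[ℂ] ⨂[ℂ] v : Λ.verts, H v :=
  letI : Fintype Λ.edges := Fintype.ofFinite _
  ∑ i : Labeling 𝒱 Λ.edges, A.blockedSummand Λ i

/-- `Λ` is an injective region: the blocked tensor along `Λ` is injective as a map from virtual to
physical spaces. -/
def IsInjectiveRegion [Finite V] (A : PEPS Γ 𝒱 H) (Λ : Γ.Subgraph) : Prop :=
  Function.Injective (A.blockedTensor Λ)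

/-- The state `|Ψ_Γ(A)⟩ ∈ ⨂_v H_v`: the contraction of all tensors over all edges of `Γ`. -/
def state [Finite V] (A : PEPS Γ 𝒱 H) : ⨂[ℂ] v, H v :=
  letI : Fintype Γ.Edge := Fintype.ofFinite _
  letI : DecidableEq Γ.Edge := Classical.decEq _
  ∑ i : (∀ e : Γ.Edge, Fin (Module.finrank ℂ (𝒱 e))),
    PiTensorProduct.tprod ℂ (fun v => A.eval
      (fun e => (Module.finBasis ℂ (𝒱 e)).coord (i e)) (fun e => Module.finBasis ℂ (𝒱 e) (i e)) v)

/-- The PEPS is normal: its tensors become injective after blocking, i.e. every vertex lies in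
some injective region. -/
def IsNormal [Finite V] (A : PEPS Γ 𝒱 H) : Prop :=
  ∀ v : V, ∃ Λ : Γ.Subgraph, v ∈ Λ.verts ∧ A.IsInjectiveRegion Λ

/-- The edge `e` has invertible neighborhoods: its two endpoints lie in two disjoint injective
regions (which therefore do not contain `e` as an edge). -/
def HasInvertibleNeighborhoods [Finite V] (A : PEPS Γ 𝒱 H) (e : Γ.Edge) : Prop :=
  ∃ Λo Λt : Γ.Subgraph, Λo.IsDisjoint Λt ∧ e.origin ∈ Λo.verts ∧ e.terminus ∈ Λt.verts ∧
    A.IsInjectiveRegion Λo ∧ A.IsInjectiveRegion Λt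

/-- The graph is big enough for the PEPS: injective regions around the two endpoints of each edge
can be chosen so that they do not overlap. -/
def IsBigEnough [Finite V] (A : PEPS Γ 𝒱 H) : Prop :=
  ∀ e : Γ.Edge, A.HasInvertibleNeighborhoods e

open Classical in
/-- An operator `T` on the single factor `H v`, acting on `⨂_w H_w` (as the identity on the other
factors). -/
def onsite (v : V) (T : H v →ₗ[ℂ] H v) : (⨂[ℂ] w, H w) →ₗ[ℂ] ⨂[ℂ] w, H w :=
  PiTensorProduct.map (Function.update (fun w => (LinearMap.id : H w →ₗ[ℂ] H w)) v T)

/-- The PEPS is locally symmetric with respect to the representations `U v` of `G` on `H v`: each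
`U v g`, acting on the factor `H v` alone, leaves the state invariant. -/
def IsLocallySymmetric [Finite V] (A : PEPS Γ 𝒱 H) {G : Type*} [Group G]
    (U : ∀ v, Representation ℂ G (H v)) : Prop :=
  ∀ (g : G) (v : V), onsite v (U v g) A.state = A.state

end PEPS

end

/-!
The symmetry `U_v(g) Ψ = Ψ` says that the contraction of the collection `B`, obtained from `A` by
replacing `A_v` with `(U_v(g) - 1) ∘ A_v`, is zero. The proof cuts the edges of this vanishing
contraction one after another until the tensors at the vertices fall apart.

An edge `e` is cut by inserting an arbitrary element of `𝒱 e* ⊗ 𝒱 e` instead of the canonical one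
`∑ₖ bₖ* ⊗ bₖ`; `PEPS.contract` is the contraction with such insertions, and `PEPS.VanishesCut B S`
says that it vanishes whatever is inserted at the edges in `S`. This property is monotone: it passes
to smaller `S`, since the canonical element is one of the possible insertions.

The central step is `PEPS.VanishesCut.union_touching`: an injective region `Λ` of `B` can be
removed. By monotonicity no edge touching `Λ` needs to be cut beforehand. A left inverse of the
blocked tensor of `Λ` provides functionals on the physical spaces of `Λ` whose composition with the blocked tensor
is any prescribed product functional on the open legs. Applied to the vanishing contraction, such a
functional leaves the contraction of the tensors outside `Λ` alone, with arbitrary prescribed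
values on the edges between `Λ` and its complement. This is therefore zero, and tensoring with
whatever is inside `Λ` shows that the contraction vanishes after cutting all edges that touch `Λ`.
The bookkeeping is done leg by leg, by `Fintype.sum_prod_smul_congr`.

Of the two disjoint injective regions around the endpoints of an edge, at least one avoids `v`, and
there `B` agrees with `A`. So every edge can be cut (`PEPS.IsBigEnough.vanishesCut_univ`), and
`⨂_w B_w` vanishes on all choices of legs. By normality `A_w ≠ 0` for all `w`, and the legs at
different vertices are independent after the cut, so it is the factor at `v` that vanishes:
`(U_v(g) - 1) ∘ A_v = 0`.
-/

/-! ### Sums over families of labels -/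

section Sums

variable {ι : Type*} [Fintype ι] [DecidableEq ι] {κ : ι → Type*} [∀ e, Fintype (κ e)]
  {M : Type*} [AddCommMonoid M] [Module ℂ M]

theorem Fintype.sum_sum_update (f : (∀ e, κ e) → M) (e : ι) :
    ∑ i : ∀ e, κ e, ∑ k : κ e, f (Function.update i e k) = (Fintype.card (κ e) : ℂ) • ∑ i, f i := by
  -- `(i, k) ↦ (update i e k, i e)` is an involution.
  let σ : (∀ e, κ e) × κ e → (∀ e, κ e) × κ e := fun p => (Function.update p.1 e p.2, p.1 e)
  have hσ : Function.Involutive σ := fun p => by simp [σ]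
  rw [← Fintype.sum_prod_type' (f := fun i k => f (Function.update i e k)),
    Fintype.sum_equiv hσ.toPerm (fun p => f (Function.update p.1 e p.2)) (fun p => f p.1)
      (fun _ => rfl),
    Fintype.sum_prod_type]
  simp only [Finset.smul_sum, Finset.sum_const, Finset.card_univ, Nat.cast_smul_eq_nsmul]

theorem Fintype.sum_sum_piecewise (S : Set ι) [DecidablePred (· ∈ S)] (f : (∀ e, κ e) → M) :
    ∑ i : ∀ e, κ e, ∑ a : ∀ e, κ e, f (S.piecewise a i) =
      (Fintype.card (∀ e, κ e) : ℂ) • ∑ i, f i := by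
  -- `(i, a) ↦ (a on S, i off S; i on S, a off S)` is an involution.
  let σ : (∀ e, κ e) × (∀ e, κ e) → (∀ e, κ e) × (∀ e, κ e) :=
    fun p => (S.piecewise p.2 p.1, S.piecewise p.1 p.2)
  have hσ : Function.Involutive σ := fun p => by
    ext e <;> by_cases he : e ∈ S <;> simp [σ, he]
  rw [← Fintype.sum_prod_type' (f := fun i a => f (S.piecewise a i)),
    Fintype.sum_equiv hσ.toPerm (fun p => f (S.piecewise p.2 p.1)) (fun p => f p.1) (fun _ => rfl),
    Fintype.sum_prod_type]
  simp only [Finset.smul_sum, Finset.sum_const, Finset.card_univ, Nat.cast_smul_eq_nsmul]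

theorem Fintype.sum_restrict [∀ e, Nonempty (κ e)] (S : Set ι) [DecidablePred (· ∈ S)]
    [Fintype (∀ e : S, κ e)] :
    ∃ c : ℂ, c ≠ 0 ∧ ∀ f : (∀ e : S, κ e) → M, ∑ a : ∀ e, κ e, f (fun e => a e) = c • ∑ i, f i := by
  refine ⟨Fintype.card (∀ e : {e // e ∉ S}, κ e), by exact_mod_cast Fintype.card_ne_zero,
    fun f => ?_⟩
  rw [Fintype.sum_equiv (Equiv.piEquivPiSubtypeProd (· ∈ S) κ) (fun a => f (fun e => a e))
    (fun p => f p.1) (fun _ => rfl), Fintype.sum_prod_type_right]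
  simp only [Finset.sum_const, Finset.card_univ, Nat.cast_smul_eq_nsmul]

/-- Weighted sums of a function of a family of legs can be compared leg by leg: if replacing the
weighted family `(w e, g e)` by `(w' e, g' e)` in the single leg `e` never changes the sum over the
labels of `e`, then replacing it in all legs does not change the total sum. -/
theorem Fintype.sum_prod_smul_congr [∀ e, Nonempty (κ e)] {N : ι → Type*}
    (G : (∀ e, N e) → M)
    (w w' : ∀ e, κ e → ℂ) (g g' : ∀ e, κ e → N e)
    (h : ∀ e n, ∑ k, w e k • G (Function.update n e (g e k)) =
      ∑ k, w' e k • G (Function.update n e (g' e k))) :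
    ∑ i : ∀ e, κ e, (∏ e, w e (i e)) • G (fun e => g e (i e)) =
      ∑ i : ∀ e, κ e, (∏ e, w' e (i e)) • G (fun e => g' e (i e)) := by
  suffices H : ∀ s : Finset ι,
      ∑ i : ∀ e, κ e, (∏ e, w e (i e)) • G (fun e => g e (i e)) =
      ∑ i : ∀ e, κ e, (∏ e, (if e ∈ s then w' e else w e) (i e)) •
        G (fun e => (if e ∈ s then g' e else g e) (i e)) by
    simpa using H Finset.univ
  intro s
  induction s using Finset.induction_on with
  | empty => simp
  | insert e s he ih =>
    rw [ih]
    have hc : (Fintype.card (κ e) : ℂ) ≠ 0 := by exact_mod_cast Fintype.card_ne_zero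
    have key : ∀ (W : ∀ e, κ e → ℂ) (Q : ∀ e, κ e → N e) (i : ∀ e, κ e) (k : κ e),
        (∏ e', W e' (Function.update i e k e')) • G (fun e' => Q e' (Function.update i e k e')) =
        (∏ e' ∈ Finset.univ.erase e, W e' (i e')) • W e k •
          G (Function.update (fun e' => Q e' (i e')) e (Q e k)) := by
      intro W Q i k
      rw [← Finset.mul_prod_erase _ _ (Finset.mem_univ e), Function.update_self, mul_comm,
        mul_smul]
      congr 1
      · refine Finset.prod_congr rfl fun e' he' => ?_
        rw [Function.update_of_ne (Finset.ne_of_mem_erase he')]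
      · congr 2
        funext e'
        by_cases h' : e' = e
        · subst h'; simp
        · simp [h']
    rw [← (IsUnit.mk0 _ hc).smul_left_cancel]
    rw [← Fintype.sum_sum_update, ← Fintype.sum_sum_update]
    refine Finset.sum_congr rfl fun i _ => ?_
    rw [Finset.sum_congr rfl fun k _ => key (fun e => if e ∈ s then w' e else w e)
        (fun e => if e ∈ s then g' e else g e) i k,
      Finset.sum_congr rfl fun k _ => key (fun e' => if e' ∈ insert e s then w' e' else w e')
        (fun e' => if e' ∈ insert e s then g' e' else g e') i k,
      ← Finset.smul_sum, ← Finset.smul_sum]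
    congr 1
    · refine Finset.prod_congr rfl fun e' he' => ?_
      simp [Finset.ne_of_mem_erase he']
    · simp only [he, if_false, Finset.mem_insert_self, if_true]
      rw [h]
      refine Finset.sum_congr rfl fun k _ => ?_
      congr 2
      funext e'
      by_cases h' : e' = e
      · subst h'; simp
      · simp [h']

end Sums

/-! ### Functionals on tensor products of families -/

section Functionals

/-- A version for additive monoids, which applies to the additive monoid structure that a
`PiTensorProduct` carries over a semiring. -/
theorem LinearMap.exists_leftInverse_of_injective_addCommMonoid {P Q : Type*}
    [AddCommMonoid P] [Module ℂ P] [AddCommMonoid Q] [Module ℂ Q] (f : P →ₗ[ℂ] Q)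
    (hf : Function.Injective f) : ∃ L : Q →ₗ[ℂ] P, L ∘ₗ f = LinearMap.id := by
  let := Module.addCommMonoidToAddCommGroup ℂ (M := P)
  let := Module.addCommMonoidToAddCommGroup ℂ (M := Q)
  exact LinearMap.exists_leftInverse_of_injective f (LinearMap.ker_eq_bot.2 hf)

theorem PiTensorProduct.exists_dual_tprod {ι : Type*} [Fintype ι] {s : ι → Type*}
    [∀ i, AddCommGroup (s i)] [∀ i, Module ℂ (s i)] (f : ∀ i, Module.Dual ℂ (s i)) :
    ∃ η : Module.Dual ℂ (⨂[ℂ] i, s i), ∀ x, η (PiTensorProduct.tprod ℂ x) = ∏ i, f i (x i) :=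
  ⟨PiTensorProduct.lift ((MultilinearMap.mkPiAlgebra ℂ ι ℂ).compLinearMap f), fun x => by simp⟩

theorem PiTensorProduct.tprod_ne_zero {ι : Type*} [Finite ι] {s : ι → Type*}
    [∀ i, AddCommGroup (s i)] [∀ i, Module ℂ (s i)] {x : ∀ i, s i} (hx : ∀ i, x i ≠ 0) :
    PiTensorProduct.tprod ℂ x ≠ 0 := by
  have := Fintype.ofFinite ι
  have h : ∀ i, ∃ f : Module.Dual ℂ (s i), f (x i) = 1 := fun i =>
    Module.Projective.exists_dual_eq_one ℂ (hx i)
  choose f hf using h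
  obtain ⟨η, hη⟩ := PiTensorProduct.exists_dual_tprod f
  intro h0
  have := hη x
  rw [h0, map_zero] at this
  simp [hf] at this

theorem TensorProduct.exists_dual_tprod_tmul {ι κ : Type*} [Fintype ι] [Fintype κ]
    {s : ι → Type*} {t : κ → Type*}
    [∀ i, AddCommGroup (s i)] [∀ i, Module ℂ (s i)]
    [∀ j, AddCommGroup (t j)] [∀ j, Module ℂ (t j)]
    (f : ∀ i, Module.Dual ℂ (s i)) (g : ∀ j, Module.Dual ℂ (t j)) :
    ∃ η : Module.Dual ℂ ((⨂[ℂ] i, s i) ⊗[ℂ] (⨂[ℂ] j, t j)), ∀ x y,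
      η (PiTensorProduct.tprod ℂ x ⊗ₜ[ℂ] PiTensorProduct.tprod ℂ y) =
        (∏ i, f i (x i)) * ∏ j, g j (y j) := by
  obtain ⟨η₁, h₁⟩ := PiTensorProduct.exists_dual_tprod f
  obtain ⟨η₂, h₂⟩ := PiTensorProduct.exists_dual_tprod g
  exact ⟨LinearMap.mul' ℂ ℂ ∘ₗ TensorProduct.map η₁ η₂, fun x y => by simp [h₁, h₂]⟩

open Classical in
/-- A functional on the factors in `W`, followed by the insertion of fixed vectors `h` into these
factors, as an operator on `⨂ᵢ sᵢ`. -/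
theorem PiTensorProduct.exists_contract_insert {ι : Type*} {s : ι → Type*}
    [∀ i, AddCommGroup (s i)] [∀ i, Module ℂ (s i)] (W : Set ι)
    (ξ : Module.Dual ℂ (⨂[ℂ] i : W, s i)) (h : ∀ i, s i) :
    ∃ T : (⨂[ℂ] i, s i) →ₗ[ℂ] ⨂[ℂ] i, s i, ∀ f : ∀ i, s i,
      T (PiTensorProduct.tprod ℂ f) = ξ (PiTensorProduct.tprod ℂ fun i : W => f i) •
        PiTensorProduct.tprod ℂ (W.piecewise h f) := by
  have hin : ∀ (f : ∀ i, s i) (i : ι) (hi : i ∈ W) (a : s i),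
      (fun j : W => Function.update f i a j) = Function.update (fun j : W => f j) ⟨i, hi⟩ a := by
    intro f i hi a
    funext j
    by_cases hj : j = ⟨i, hi⟩
    · subst hj; simp
    · rw [Function.update_of_ne hj, Function.update_of_ne fun h' => hj (Subtype.ext h')]
  have hin' : ∀ (f : ∀ i, s i) (i : ι) (_ : i ∈ W) (a : s i),
      W.piecewise h (Function.update f i a) = W.piecewise h f := by
    intro f i hi a
    funext j
    by_cases hj : j ∈ W
    · simp [hj]
    · have : j ≠ i := fun h' => hj (h' ▸ hi)
      simp [hj, this]
  have hout : ∀ (f : ∀ i, s i) (i : ι) (_ : i ∉ W) (a : s i),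
      (fun j : W => Function.update f i a j) = fun j : W => f j := by
    intro f i hi a
    funext j
    rw [Function.update_of_ne]
    exact fun h' => hi (h' ▸ j.2)
  have hout' : ∀ (f : ∀ i, s i) (i : ι) (_ : i ∉ W) (a : s i),
      W.piecewise h (Function.update f i a) = Function.update (W.piecewise h f) i a := by
    intro f i hi a
    funext j
    by_cases hj : j = i
    · subst hj; simp [hi]
    · by_cases hj' : j ∈ W <;> simp [hj, hj']
  let m : MultilinearMap ℂ s (⨂[ℂ] i, s i) :=
    { toFun := fun f => ξ (PiTensorProduct.tprod ℂ fun i : W => f i) •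
        PiTensorProduct.tprod ℂ (W.piecewise h f)
      map_update_add' := by
        intro inst f i a b
        rw [Subsingleton.elim inst (fun a b => propDecidable (a = b))]
        by_cases hi : i ∈ W
        · simp only [hin _ _ hi, hin' _ _ hi, MultilinearMap.map_update_add, map_add, add_smul]
        · simp only [hout _ _ hi, hout' _ _ hi, MultilinearMap.map_update_add, smul_add]
      map_update_smul' := by
        intro inst f i c a
        rw [Subsingleton.elim inst (fun a b => propDecidable (a = b))]
        by_cases hi : i ∈ W
        · simp only [hin _ _ hi, hin' _ _ hi, MultilinearMap.map_update_smul, map_smul,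
            smul_assoc]
        · simp only [hout _ _ hi, hout' _ _ hi, MultilinearMap.map_update_smul]
          rw [smul_comm] }
  exact ⟨PiTensorProduct.lift m, fun f => by simp [m]⟩

end Functionals

/-! ### Contractions with cut edges -/

noncomputable section

namespace PEPS

variable {V : Type*} {Γ : OrientedGraph V} {𝒱 : Γ.Edge → Type*} {H : V → Type*}
  [∀ e, AddCommGroup (𝒱 e)] [∀ e, Module ℂ (𝒱 e)]
  [∀ v, AddCommGroup (H v)] [∀ v, Module ℂ (H v)]

/-- The tensor at `v` evaluated at a family `n` of pairs: the functional `(n e).1` is inserted at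
the origin of `e`, the vector `(n e).2` at its terminus. -/
def evalLegs (B : PEPS Γ 𝒱 H) (n : ∀ e, Module.Dual ℂ (𝒱 e) × 𝒱 e) (v : V) : H v :=
  B.eval (fun e => (n e).1) (fun e => (n e).2) v

theorem evalLegs_congr (B : PEPS Γ 𝒱 H) {n n' : ∀ e, Module.Dual ℂ (𝒱 e) × 𝒱 e} {v : V}
    (h : ∀ e, e.origin = v → (n e).1 = (n' e).1)
    (h' : ∀ e, e.terminus = v → (n e).2 = (n' e).2) :
    B.evalLegs n v = B.evalLegs n' v :=
  B.eval_congr h h'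

theorem evalLegs_update_of_ne [DecidableEq Γ.Edge] (B : PEPS Γ 𝒱 H)
    (n : ∀ e, Module.Dual ℂ (𝒱 e) × 𝒱 e)
    (e : Γ.Edge) (a : Module.Dual ℂ (𝒱 e) × 𝒱 e) {v : V} (ho : e.origin ≠ v)
    (ht : e.terminus ≠ v) : B.evalLegs (Function.update n e a) v = B.evalLegs n v := by
  refine B.evalLegs_congr (fun e' h => ?_) (fun e' h => ?_)
  · rw [Function.update_of_ne]
    rintro rfl
    exact ho h
  · rw [Function.update_of_ne]
    rintro rfl
    exact ht h

theorem _root_.OrientedGraph.Edge.origin_ne_terminus (e : Γ.Edge) : e.origin ≠ e.terminus := by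
  intro h
  have h1 := e.2
  change Γ.Adj e.origin e.terminus at h1
  rw [h] at h1
  exact Γ.asymm h1 h1

theorem exists_evalLegs_update_origin [DecidableEq Γ.Edge] (B : PEPS Γ 𝒱 H)
    (n : ∀ e, Module.Dual ℂ (𝒱 e) × 𝒱 e) (e : Γ.Edge) :
    ∃ L : Module.Dual ℂ (𝒱 e) →ₗ[ℂ] H e.origin, ∀ a,
      B.evalLegs (Function.update n e a) e.origin = L a.1 := by
  classical
  let e₀ : Γ.outEdges e.origin := ⟨e, rfl⟩
  refine ⟨(B e.origin) ∘ₗ ((TensorProduct.mk ℂ _ _).flip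
      (PiTensorProduct.tprod ℂ (fun e : Γ.inEdges e.origin => (n e).2))) ∘ₗ
      ((PiTensorProduct.tprod ℂ).toLinearMap
        (fun e' : Γ.outEdges e.origin => (n e').1) e₀), fun a => ?_⟩
  simp only [evalLegs, eval, LinearMap.comp_apply, MultilinearMap.toLinearMap_apply,
    LinearMap.flip_apply, TensorProduct.mk_apply]
  congr 3
  · funext e'
    by_cases h : e' = e₀
    · subst h
      simp [e₀]
    · have h' : (e' : Γ.Edge) ≠ e := fun hh => h (Subtype.ext hh)
      rw [Function.update_of_ne h, Function.update_of_ne h']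
  · funext e'
    rw [Function.update_of_ne]
    intro h
    exact e.origin_ne_terminus ((congrArg _ h).symm.trans e'.2).symm

theorem exists_evalLegs_update_terminus [DecidableEq Γ.Edge] (B : PEPS Γ 𝒱 H)
    (n : ∀ e, Module.Dual ℂ (𝒱 e) × 𝒱 e) (e : Γ.Edge) :
    ∃ L : 𝒱 e →ₗ[ℂ] H e.terminus, ∀ a,
      B.evalLegs (Function.update n e a) e.terminus = L a.2 := by
  classical
  let e₀ : Γ.inEdges e.terminus := ⟨e, rfl⟩
  refine ⟨(B e.terminus) ∘ₗ ((TensorProduct.mk ℂ _ _)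
      (PiTensorProduct.tprod ℂ (fun e : Γ.outEdges e.terminus => (n e).1))) ∘ₗ
      ((PiTensorProduct.tprod ℂ).toLinearMap
        (fun e' : Γ.inEdges e.terminus => (n e').2) e₀), fun a => ?_⟩
  simp only [evalLegs, eval, LinearMap.comp_apply, MultilinearMap.toLinearMap_apply,
    TensorProduct.mk_apply]
  congr 3
  · funext e'
    rw [Function.update_of_ne]
    intro h
    exact e.origin_ne_terminus ((congrArg _ h).symm.trans e'.2)
  · funext e'
    by_cases h : e' = e₀
    · subst h
      simp [e₀]
    · have h' : (e' : Γ.Edge) ≠ e := fun hh => h (Subtype.ext hh)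
      rw [Function.update_of_ne h, Function.update_of_ne h']

section Outside

open Classical in
/-- The tensors outside `W` evaluated at the legs `n`, with fixed vectors `h` in the physical
spaces of `W`. -/
def outsideTensor (B : PEPS Γ 𝒱 H) (W : Set V) (h : ∀ v, H v)
    (n : ∀ e, Module.Dual ℂ (𝒱 e) × 𝒱 e) : ⨂[ℂ] v, H v :=
  PiTensorProduct.tprod ℂ (W.piecewise h (B.evalLegs n))

variable [DecidableEq Γ.Edge] (B : PEPS Γ 𝒱 H) (W : Set V) (h : ∀ v, H v)
    (n : ∀ e, Module.Dual ℂ (𝒱 e) × 𝒱 e) (e : Γ.Edge)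

theorem outsideTensor_update_inside (ho : e.origin ∈ W) (ht : e.terminus ∈ W)
    (a : Module.Dual ℂ (𝒱 e) × 𝒱 e) :
    B.outsideTensor W h (Function.update n e a) = B.outsideTensor W h n := by
  classical
  unfold outsideTensor
  congr 1
  funext v
  by_cases hv : v ∈ W
  · simp [hv]
  · rw [Set.piecewise_eq_of_notMem _ _ _ hv, Set.piecewise_eq_of_notMem _ _ _ hv]
    exact B.evalLegs_update_of_ne n e a (fun h => hv (h ▸ ho)) (fun h => hv (h ▸ ht))

theorem exists_outsideTensor_update_terminus (ho : e.origin ∈ W) (ht : e.terminus ∉ W) :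
    ∃ L : 𝒱 e →ₗ[ℂ] ⨂[ℂ] v, H v, ∀ a,
      B.outsideTensor W h (Function.update n e a) = L a.2 := by
  classical
  obtain ⟨L, hL⟩ := B.exists_evalLegs_update_terminus n e
  refine ⟨((PiTensorProduct.tprod ℂ).toLinearMap (W.piecewise h (B.evalLegs n)) e.terminus) ∘ₗ L,
    fun a => ?_⟩
  simp only [outsideTensor, LinearMap.comp_apply, MultilinearMap.toLinearMap_apply, ← hL]
  congr 1
  funext v
  by_cases hv : v = e.terminus
  · subst hv
    simp [ht]
  · rw [Function.update_of_ne hv]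
    by_cases hv' : v ∈ W
    · simp [hv']
    · rw [Set.piecewise_eq_of_notMem _ _ _ hv', Set.piecewise_eq_of_notMem _ _ _ hv']
      exact B.evalLegs_update_of_ne n e a (fun h => hv' (h ▸ ho)) (fun h => hv h.symm)

theorem exists_outsideTensor_update_origin (ho : e.origin ∉ W) (ht : e.terminus ∈ W) :
    ∃ L : Module.Dual ℂ (𝒱 e) →ₗ[ℂ] ⨂[ℂ] v, H v, ∀ a,
      B.outsideTensor W h (Function.update n e a) = L a.1 := by
  classical
  obtain ⟨L, hL⟩ := B.exists_evalLegs_update_origin n e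
  refine ⟨((PiTensorProduct.tprod ℂ).toLinearMap (W.piecewise h (B.evalLegs n)) e.origin) ∘ₗ L,
    fun a => ?_⟩
  simp only [outsideTensor, LinearMap.comp_apply, MultilinearMap.toLinearMap_apply, ← hL]
  congr 1
  funext v
  by_cases hv : v = e.origin
  · subst hv
    simp [ho]
  · rw [Function.update_of_ne hv]
    by_cases hv' : v ∈ W
    · simp [hv']
    · rw [Set.piecewise_eq_of_notMem _ _ _ hv', Set.piecewise_eq_of_notMem _ _ _ hv']
      exact B.evalLegs_update_of_ne n e a (fun h => hv h.symm) (fun h => hv' (h ▸ ht))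

end Outside

variable [∀ e, FiniteDimensional ℂ (𝒱 e)]

theorem blockedTensor_tprod [Finite V] (B : PEPS Γ 𝒱 H) (Λ : Γ.Subgraph)
    [Fintype (Labeling 𝒱 Λ.edges)]
    (φ : ∀ e : Λ.openOut, Module.Dual ℂ (𝒱 e)) (x : ∀ e : Λ.openIn, 𝒱 e) :
    B.blockedTensor Λ (PiTensorProduct.tprod ℂ φ ⊗ₜ[ℂ] PiTensorProduct.tprod ℂ x) =
      ∑ i : Labeling 𝒱 Λ.edges, PiTensorProduct.tprod ℂ
        (fun v : Λ.verts => B.eval (outLegs Λ i φ) (inLegs Λ i x) v) := by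
  simp only [blockedTensor, LinearMap.sum_apply, blockedSummand, PiTensorProduct.biLift_tprod,
    MultilinearMap.coe_mk]
  congr!

variable (𝒱) in
/-- The pairs of dual basis vectors and basis vectors inserted at an edge to contract it. -/
def basisLegs (e : Γ.Edge) (k : Fin (Module.finrank ℂ (𝒱 e))) : Module.Dual ℂ (𝒱 e) × 𝒱 e :=
  ((Module.finBasis ℂ (𝒱 e)).coord k, Module.finBasis ℂ (𝒱 e) k)

theorem sum_coord_smul_basisLegs {M : Type*} [AddCommGroup M] [Module ℂ M] {e : Γ.Edge}
    (L : 𝒱 e →ₗ[ℂ] M) (y : 𝒱 e) :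
    ∑ k, (basisLegs 𝒱 e k).1 y • L (basisLegs 𝒱 e k).2 = L y := by
  simp only [basisLegs, ← map_smul, ← map_sum, Module.Basis.coord_apply, Module.Basis.sum_repr]

theorem sum_apply_smul_basisLegs {M : Type*} [AddCommGroup M] [Module ℂ M] {e : Γ.Edge}
    (L : Module.Dual ℂ (𝒱 e) →ₗ[ℂ] M) (ψ : Module.Dual ℂ (𝒱 e)) :
    ∑ k, ψ (basisLegs 𝒱 e k).2 • L (basisLegs 𝒱 e k).1 = L ψ := by
  simp only [basisLegs, ← map_smul, ← map_sum, Module.Basis.sum_dual_apply_smul_coord]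

variable [Fintype Γ.Edge] [DecidableEq Γ.Edge]

/-- The contraction of all tensors of `B` in which the edge `e` carries the element
`∑ₖ (p e k).1 ⊗ (p e k).2` of `𝒱* ⊗ 𝒱`. The genuine contraction over `e` is the case
`p e = basisLegs 𝒱 e`; allowing arbitrary elements amounts to cutting `e`. -/
def contract (B : PEPS Γ 𝒱 H)
    (p : ∀ e, Fin (Module.finrank ℂ (𝒱 e)) → Module.Dual ℂ (𝒱 e) × 𝒱 e) : ⨂[ℂ] v, H v :=
  ∑ i : (∀ e : Γ.Edge, Fin (Module.finrank ℂ (𝒱 e))),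
    PiTensorProduct.tprod ℂ (B.evalLegs fun e => p e (i e))

/-- The contraction of `B` vanishes after cutting the edges in `S`, whatever is inserted there. -/
def VanishesCut (B : PEPS Γ 𝒱 H) (S : Set Γ.Edge) : Prop :=
  ∀ p : ∀ e, Fin (Module.finrank ℂ (𝒱 e)) → Module.Dual ℂ (𝒱 e) × 𝒱 e,
    (∀ e ∉ S, p e = basisLegs 𝒱 e) → B.contract p = 0

theorem VanishesCut.anti {B : PEPS Γ 𝒱 H}
    {S S' : Set Γ.Edge} (h : B.VanishesCut S)
    (hS : S' ⊆ S) : B.VanishesCut S' :=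
  fun p hp => h p fun e he => hp e fun he' => he (hS he')

end PEPS

end

/-! ### Removing an injective region -/

noncomputable section

/-- The edges with at least one endpoint in the vertex set of `Λ`. -/
def OrientedGraph.Subgraph.touching {V : Type*} {Γ : OrientedGraph V} (Λ : Γ.Subgraph) :
    Set Γ.Edge :=
  {e | e.origin ∈ Λ.verts ∨ e.terminus ∈ Λ.verts}

namespace PEPS

variable {V : Type*} {Γ : OrientedGraph V} {𝒱 : Γ.Edge → Type*} {H : V → Type*}
  [∀ e, AddCommGroup (𝒱 e)] [∀ e, Module ℂ (𝒱 e)]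
  [∀ v, AddCommGroup (H v)] [∀ v, Module ℂ (H v)]
  [∀ e, FiniteDimensional ℂ (𝒱 e)]

instance [∀ e, Nontrivial (𝒱 e)] (e : Γ.Edge) : Nonempty (Fin (Module.finrank ℂ (𝒱 e))) :=
  ⟨⟨0, Module.finrank_pos⟩⟩

open Classical in
/-- Summing over the labels of the edges of `Λ` produces the blocked tensor. The sum runs over
labels of all edges, whence the multiplicity `c`. -/
theorem exists_sum_tprod_eq_blockedTensor [Finite V] [Fintype Γ.Edge]
    [DecidableEq Γ.Edge] [∀ e, Nontrivial (𝒱 e)] (B : PEPS Γ 𝒱 H)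
    (Λ : Γ.Subgraph) :
    ∃ c : ℂ, c ≠ 0 ∧ ∀ i : (∀ e : Γ.Edge, Fin (Module.finrank ℂ (𝒱 e))),
      ∑ a : (∀ e : Γ.Edge, Fin (Module.finrank ℂ (𝒱 e))), PiTensorProduct.tprod ℂ
        (fun v : Λ.verts => B.evalLegs (fun e => basisLegs 𝒱 e (Λ.edges.piecewise a i e)) v) =
      c • B.blockedTensor Λ
        (PiTensorProduct.tprod ℂ (fun e : Λ.openOut => (basisLegs 𝒱 e (i e)).1) ⊗ₜ[ℂ]
          PiTensorProduct.tprod ℂ (fun e : Λ.openIn => (basisLegs 𝒱 e (i e)).2)) := by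
  obtain ⟨c, hc, h⟩ := Fintype.sum_restrict (M := ⨂[ℂ] v : Λ.verts, H v)
    (κ := fun e : Γ.Edge => Fin (Module.finrank ℂ (𝒱 e))) Λ.edges
  refine ⟨c, hc, fun i => ?_⟩
  rw [blockedTensor_tprod, ← h]
  refine Finset.sum_congr rfl fun a _ => ?_
  congr 1
  funext v
  refine B.eval_congr (fun e he => ?_) (fun e he => ?_)
  · have hv : e.origin ∈ Λ.verts := he ▸ v.2
    by_cases h1 : e ∈ Λ.edges
    · simp [outLegs, h1, basisLegs]
    · have h2 : e ∈ Λ.openOut := by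
        by_cases h3 : e.terminus ∈ Λ.verts
        · exact Or.inr ⟨h1, hv, h3⟩
        · exact Or.inl ⟨h1, hv, h3⟩
      simp [outLegs, h1, h2, basisLegs]
  · have hv : e.terminus ∈ Λ.verts := he ▸ v.2
    by_cases h1 : e ∈ Λ.edges
    · simp [inLegs, h1, basisLegs]
    · have h2 : e ∈ Λ.openIn := by
        by_cases h3 : e.origin ∈ Λ.verts
        · exact Or.inr ⟨h1, h3, hv⟩
        · exact Or.inl ⟨h1, h3, hv⟩
      simp [inLegs, h1, h2, basisLegs]

open Classical in
/-- The weight of the label `k` of the edge `e` under the functional that evaluates open outgoing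
legs of `Λ` at `y` and open incoming legs at `ψ`. -/
def openWeight (Λ : Γ.Subgraph) (y : ∀ e, 𝒱 e) (ψ : ∀ e, Module.Dual ℂ (𝒱 e)) (e : Γ.Edge)
    (k : Fin (Module.finrank ℂ (𝒱 e))) : ℂ :=
  (if e ∈ Λ.openOut then (basisLegs 𝒱 e k).1 (y e) else 1) *
    (if e ∈ Λ.openIn then ψ e (basisLegs 𝒱 e k).2 else 1)

open Classical in
/-- The left inverse of an injective blocked tensor turns functionals on the virtual spaces into
functionals on the physical spaces. -/
theorem IsInjectiveRegion.exists_dual [Finite V] [Fintype Γ.Edge] {B : PEPS Γ 𝒱 H} {Λ : Γ.Subgraph}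
    (hΛ : B.IsInjectiveRegion Λ) (y : ∀ e, 𝒱 e) (ψ : ∀ e, Module.Dual ℂ (𝒱 e)) :
    ∃ ξ : Module.Dual ℂ (⨂[ℂ] v : Λ.verts, H v),
      ∀ i : (∀ e : Γ.Edge, Fin (Module.finrank ℂ (𝒱 e))),
      ξ (B.blockedTensor Λ
        (PiTensorProduct.tprod ℂ (fun e : Λ.openOut => (basisLegs 𝒱 e (i e)).1) ⊗ₜ[ℂ]
          PiTensorProduct.tprod ℂ (fun e : Λ.openIn => (basisLegs 𝒱 e (i e)).2))) =
        ∏ e, openWeight Λ y ψ e (i e) := by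
  obtain ⟨L, hL⟩ := LinearMap.exists_leftInverse_of_injective_addCommMonoid _ hΛ
  obtain ⟨η, hη⟩ := TensorProduct.exists_dual_tprod_tmul
    (fun e : Λ.openOut => Module.Dual.eval ℂ (𝒱 e) (y e)) (fun e : Λ.openIn => ψ e)
  refine ⟨η ∘ₗ L, fun i => ?_⟩
  rw [LinearMap.comp_apply, ← LinearMap.comp_apply L, hL, LinearMap.id_apply, hη]
  unfold openWeight
  rw [Finset.prod_mul_distrib]
  congr 1
  · rw [Finset.prod_ite, Finset.prod_const_one, mul_one]
    exact (Finset.prod_subtype _ (by simp)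
      (fun e : Γ.Edge => (basisLegs 𝒱 e (i e)).1 (y e))).symm
  · rw [Finset.prod_ite, Finset.prod_const_one, mul_one]
    exact (Finset.prod_subtype _ (by simp)
      (fun e : Γ.Edge => ψ e (basisLegs 𝒱 e (i e)).2)).symm

/-- For a touching edge and arbitrary legs `m e` there are weights `y`, `ψ` for which the weighted
sum over a basis inserted at `e` agrees with the sum over labels in which `m e` is inserted for
each label. -/
theorem exists_openWeight_sum [DecidableEq Γ.Edge] [∀ e, Nontrivial (𝒱 e)] (B : PEPS Γ 𝒱 H)
    (Λ : Γ.Subgraph)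
    (h : ∀ v, H v) (m : ∀ e, Module.Dual ℂ (𝒱 e) × 𝒱 e) :
    ∃ (y : ∀ e, 𝒱 e) (ψ : ∀ e, Module.Dual ℂ (𝒱 e)), ∀ e ∈ Λ.touching, ∀ n,
      ∑ k, openWeight Λ y ψ e k • B.outsideTensor Λ.verts h
        (Function.update n e (basisLegs 𝒱 e k)) =
      ∑ _k : Fin (Module.finrank ℂ (𝒱 e)), B.outsideTensor Λ.verts h
        (Function.update n e (m e)) := by
  classical
  -- The factor `finrank` compensates for the constant sum on the right hand side.
  have key : ∀ e, ∃ (y : 𝒱 e) (ψ : Module.Dual ℂ (𝒱 e)), e ∈ Λ.touching → ∀ n,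
      ∑ k, ((if e ∈ Λ.openOut then (basisLegs 𝒱 e k).1 y else 1) *
        (if e ∈ Λ.openIn then ψ (basisLegs 𝒱 e k).2 else 1)) • B.outsideTensor Λ.verts h
        (Function.update n e (basisLegs 𝒱 e k)) =
      ∑ _k : Fin (Module.finrank ℂ (𝒱 e)), B.outsideTensor Λ.verts h
        (Function.update n e (m e)) := by
    intro e
    by_cases ho : e.origin ∈ Λ.verts <;> by_cases ht : e.terminus ∈ Λ.verts
    · obtain ⟨z, hz⟩ := exists_ne (0 : 𝒱 e)
      obtain ⟨ψ, hψ⟩ := Module.Projective.exists_dual_eq_one ℂ hz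
      refine ⟨(Module.finrank ℂ (𝒱 e) : ℂ) • z, ψ, fun _ n => ?_⟩
      simp only [B.outsideTensor_update_inside _ h n e ho ht, ← Finset.sum_smul]
      by_cases he : e ∈ Λ.edges
      · have h1 : e ∉ Λ.openOut := fun h => by rcases h with h | h <;> exact h.1 he
        have h2 : e ∉ Λ.openIn := fun h => by rcases h with h | h <;> exact h.1 he
        simp [h1, h2, Nat.cast_smul_eq_nsmul]
      · have h1 : e ∈ Λ.openOut := Or.inr ⟨he, ho, ht⟩
        have h2 : e ∈ Λ.openIn := Or.inr ⟨he, ho, ht⟩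
        have := sum_coord_smul_basisLegs ψ ((Module.finrank ℂ (𝒱 e) : ℂ) • z)
        simp only [smul_eq_mul] at this
        simp only [h1, h2, if_true, this]
        simp [hψ, Nat.cast_smul_eq_nsmul]
    · refine ⟨(Module.finrank ℂ (𝒱 e) : ℂ) • (m e).2, 0, fun _ n => ?_⟩
      obtain ⟨L, hL⟩ := B.exists_outsideTensor_update_terminus Λ.verts h n e ho ht
      have h1 : e ∈ Λ.openOut := Or.inl ⟨fun he => ht (Λ.terminus_mem e he), ho, ht⟩
      have h2 : e ∉ Λ.openIn := fun h => by rcases h with h | h <;> exact ht h.2.2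
      simp only [h1, h2, if_true, if_false, mul_one, hL, sum_coord_smul_basisLegs]
      simp [Nat.cast_smul_eq_nsmul]
    · refine ⟨0, (Module.finrank ℂ (𝒱 e) : ℂ) • (m e).1, fun _ n => ?_⟩
      obtain ⟨L, hL⟩ := B.exists_outsideTensor_update_origin Λ.verts h n e ho ht
      have h1 : e ∉ Λ.openOut := fun h => by rcases h with h | h <;> exact ho h.2.1
      have h2 : e ∈ Λ.openIn := Or.inl ⟨fun he => ho (Λ.origin_mem e he), ho, ht⟩
      simp only [h1, h2, if_true, if_false, one_mul, hL, sum_apply_smul_basisLegs]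
      simp [Nat.cast_smul_eq_nsmul]
    · exact ⟨0, 0, fun he => absurd he (by simp [OrientedGraph.Subgraph.touching, ho, ht])⟩
  choose y ψ hy using key
  exact ⟨y, ψ, fun e he n => hy e he n⟩

/-- An injective region can be removed: if the contraction of `B` vanishes after cutting `S`, then
so do the tensors outside `Λ` on their own, hence the contraction still vanishes after cutting all
edges touching `Λ`. -/
theorem VanishesCut.union_touching [Finite V] [Fintype Γ.Edge] [DecidableEq Γ.Edge]
    [∀ e, Nontrivial (𝒱 e)] {B : PEPS Γ 𝒱 H} {S : Set Γ.Edge}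
    (hS : B.VanishesCut S) {Λ : Γ.Subgraph} (hΛ : B.IsInjectiveRegion Λ) :
    B.VanishesCut (S ∪ Λ.touching) := by
  classical
  intro p hp
  set T := Λ.touching
  set W := Λ.verts
  have hto : ∀ {e : Γ.Edge}, e.origin ∈ W → e ∈ T := fun h => Or.inl h
  have htt : ∀ {e : Γ.Edge}, e.terminus ∈ W → e ∈ T := fun h => Or.inr h
  -- It suffices to treat constant legs on the touching edges.
  have hcard : (Fintype.card (∀ e : Γ.Edge, Fin (Module.finrank ℂ (𝒱 e))) : ℂ) ≠ 0 := by
    exact_mod_cast Fintype.card_ne_zero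
  refine (smul_eq_zero_iff_right hcard).1 ?_
  rw [contract, ← Fintype.sum_sum_piecewise T, Finset.sum_comm]
  refine Finset.sum_eq_zero fun a _ => ?_
  let m : ∀ e, Module.Dual ℂ (𝒱 e) × 𝒱 e := fun e => p e (a e)
  let q : ∀ e, Fin (Module.finrank ℂ (𝒱 e)) → Module.Dual ℂ (𝒱 e) × 𝒱 e :=
    fun e k => if e ∈ T then m e else p e k
  let r : ∀ e, Fin (Module.finrank ℂ (𝒱 e)) → Module.Dual ℂ (𝒱 e) × 𝒱 e :=
    fun e k => if e ∈ T then basisLegs 𝒱 e k else p e k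
  let h : ∀ v, H v := B.evalLegs m
  have hq : ∀ i : (∀ e : Γ.Edge, Fin (Module.finrank ℂ (𝒱 e))),
      PiTensorProduct.tprod ℂ (B.evalLegs fun e => p e (T.piecewise a i e)) =
      B.outsideTensor W h (fun e => q e (i e)) := by
    intro i
    have h1 : (fun e => p e (T.piecewise a i e)) = fun e => q e (i e) := by
      funext e
      by_cases he : e ∈ T <;> simp [q, m, he]
    rw [h1, outsideTensor]
    congr 1
    funext v
    by_cases hv : v ∈ W
    · rw [Set.piecewise_eq_of_mem _ _ _ hv]
      refine B.evalLegs_congr (fun e he => ?_) (fun e he => ?_)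
      · simp [q, hto (he ▸ hv)]
      · simp [q, htt (he ▸ hv)]
    · rw [Set.piecewise_eq_of_notMem _ _ _ hv]
  simp only [hq]
  obtain ⟨y, ψ, hyψ⟩ := B.exists_openWeight_sum Λ h m
  obtain ⟨ξ, hξ⟩ := hΛ.exists_dual y ψ
  obtain ⟨F, hF⟩ := PiTensorProduct.exists_contract_insert W ξ h
  obtain ⟨c, hc, hcsum⟩ := B.exists_sum_tprod_eq_blockedTensor Λ
  have hr : B.contract r = 0 := by
    refine hS.anti (S' := S \ T) Set.sdiff_subset r fun e he => ?_
    funext k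
    by_cases hT' : e ∈ T
    · simp [r, hT']
    · have : e ∉ S ∪ T := by
        rintro (h' | h')
        · exact he ⟨h', hT'⟩
        · exact hT' h'
      simp [r, hT', hp e this]
  -- Applying the functional `ξ` to the region contracts its open legs with `y` and `ψ`.
  have hg : ∀ i a : (∀ e : Γ.Edge, Fin (Module.finrank ℂ (𝒱 e))),
      F (PiTensorProduct.tprod ℂ (B.evalLegs fun e => r e (Λ.edges.piecewise a i e))) =
      ξ (PiTensorProduct.tprod ℂ
        (fun v : W => B.evalLegs (fun e => basisLegs 𝒱 e (Λ.edges.piecewise a i e)) v)) •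
        B.outsideTensor W h (fun e => r e (i e)) := by
    intro i a
    rw [hF, outsideTensor]
    congr 1
    · congr 2
      funext v
      refine B.evalLegs_congr (fun e he => ?_) (fun e he => ?_)
      · have : e ∈ T := hto (he ▸ v.2)
        simp only [r, if_pos this]
      · have : e ∈ T := htt (he ▸ v.2)
        simp only [r, if_pos this]
    · congr 1
      funext v
      by_cases hv : v ∈ W
      · simp only [Set.piecewise_eq_of_mem _ _ _ hv]
      · simp only [Set.piecewise_eq_of_notMem _ _ _ hv]
        refine B.evalLegs_congr (fun e he => ?_) (fun e he => ?_)
        · have : e ∉ Λ.edges := fun h' => hv (he ▸ Λ.origin_mem e h')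
          exact congrArg (fun k => (r e k).1) (Set.piecewise_eq_of_notMem _ _ _ this)
        · have : e ∉ Λ.edges := fun h' => hv (he ▸ Λ.terminus_mem e h')
          exact congrArg (fun k => (r e k).2) (Set.piecewise_eq_of_notMem _ _ _ this)
  have hsum : ∑ i : (∀ e : Γ.Edge, Fin (Module.finrank ℂ (𝒱 e))),
      (∏ e, openWeight Λ y ψ e (i e)) • B.outsideTensor W h (fun e => r e (i e)) = 0 := by
    refine (smul_eq_zero_iff_right hc).1 ?_
    have h0 := congrArg F hr
    rw [contract, map_sum, map_zero] at h0
    have h1 := Fintype.sum_sum_piecewise Λ.edges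
      (fun i : (∀ e : Γ.Edge, Fin (Module.finrank ℂ (𝒱 e))) =>
        F (PiTensorProduct.tprod ℂ (B.evalLegs fun e => r e (i e))))
    rw [h0, smul_zero] at h1
    rw [← h1, Finset.smul_sum]
    refine Finset.sum_congr rfl fun i _ => ?_
    simp only [hg]
    rw [← Finset.sum_smul, ← map_sum, hcsum, map_smul, hξ, smul_assoc]
  -- Leg by leg, the weighted sum over a basis can be traded for the constant legs `m`.
  have hcomp := Fintype.sum_prod_smul_congr (B.outsideTensor W h) (openWeight Λ y ψ)
    (fun _ _ => 1) r q (by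
      intro e n
      by_cases he : e ∈ T
      · simpa [r, q, he] using hyψ e he n
      · have h1 : e ∉ Λ.openOut := fun h' => he (hto (openOut_origin_mem ⟨e, h'⟩))
        have h2 : e ∉ Λ.openIn := fun h' => he (htt (openIn_terminus_mem ⟨e, h'⟩))
        simp [r, q, he, openWeight, h1, h2])
  rw [hsum] at hcomp
  simpa using hcomp.symm

end PEPS

end

/-! ### Locally symmetric states -/

noncomputable section

namespace PEPS

variable {V : Type*} {Γ : OrientedGraph V} {𝒱 : Γ.Edge → Type*} {H : V → Type*}
  [∀ e, AddCommGroup (𝒱 e)] [∀ e, Module ℂ (𝒱 e)]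
  [∀ v, AddCommGroup (H v)] [∀ v, Module ℂ (H v)]

open Classical in
/-- Replacing `A v` by `(T - 1) ∘ A v` turns the state `Ψ` into `T Ψ - Ψ`. -/
theorem contract_update_comp [Fintype Γ.Edge] [DecidableEq Γ.Edge] (A : PEPS Γ 𝒱 H) (v : V)
    (T : H v →ₗ[ℂ] H v)
    (p : ∀ e, Fin (Module.finrank ℂ (𝒱 e)) → Module.Dual ℂ (𝒱 e) × 𝒱 e) :
    contract (Function.update A v ((T - LinearMap.id) ∘ₗ A v)) p + A.contract p =
      onsite v T (A.contract p) := by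
  unfold contract
  rw [map_sum, ← Finset.sum_add_distrib]
  refine Finset.sum_congr rfl fun i _ => ?_
  set n : ∀ e, Module.Dual ℂ (𝒱 e) × 𝒱 e := fun e => p e (i e)
  have hB : evalLegs (Function.update A v ((T - LinearMap.id) ∘ₗ A v)) n =
      Function.update (A.evalLegs n) v (T (A.evalLegs n v) - A.evalLegs n v) := by
    funext w
    by_cases hw : w = v
    · subst hw
      simp [evalLegs, eval]
    · simp [evalLegs, eval, hw]
  have hT : onsite v T (PiTensorProduct.tprod ℂ (A.evalLegs n)) =
      PiTensorProduct.tprod ℂ (Function.update (A.evalLegs n) v (T (A.evalLegs n v))) := by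
    rw [onsite, PiTensorProduct.map_tprod]
    congr 1
    funext w
    by_cases hw : w = v
    · subst hw
      simp
    · simp [hw]
  rw [hT, hB]
  conv_lhs => rw [← Function.update_eq_self v (A.evalLegs n)]
  rw [Function.update_idem, ← MultilinearMap.map_update_add]
  simp

variable [∀ e, FiniteDimensional ℂ (𝒱 e)]

/-- Injectivity of a region only depends on the tensors at its vertices. -/
theorem IsInjectiveRegion.congr [Finite V] {A B : PEPS Γ 𝒱 H} {Λ : Γ.Subgraph}
    (hA : A.IsInjectiveRegion Λ)
    (h : ∀ v ∈ Λ.verts, B v = A v) : B.IsInjectiveRegion Λ := by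
  have heq : B.blockedTensor Λ = A.blockedTensor Λ := by
    classical
    have := Fintype.ofFinite Λ.edges
    apply TensorProduct.ext
    ext φ x
    change B.blockedTensor Λ (PiTensorProduct.tprod ℂ φ ⊗ₜ[ℂ] PiTensorProduct.tprod ℂ x) =
      A.blockedTensor Λ (PiTensorProduct.tprod ℂ φ ⊗ₜ[ℂ] PiTensorProduct.tprod ℂ x)
    rw [blockedTensor_tprod, blockedTensor_tprod]
    refine Finset.sum_congr rfl fun i _ => ?_
    congr 1
    funext v
    simp only [eval, h v v.2]
  unfold IsInjectiveRegion
  rw [heq]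
  exact hA

/-- The tensor at a vertex of an injective region does not vanish. -/
theorem IsInjectiveRegion.exists_evalLegs_ne_zero [Finite V] [∀ e, Nontrivial (𝒱 e)]
    {A : PEPS Γ 𝒱 H}
    {Λ : Γ.Subgraph} (hΛ : A.IsInjectiveRegion Λ) {v : V} (hv : v ∈ Λ.verts) :
    ∃ n, A.evalLegs n v ≠ 0 := by
  classical
  by_contra! hzero
  have := Fintype.ofFinite Γ.Edge
  have := Fintype.ofFinite Λ.edges
  have := Fintype.ofFinite Λ.openOut
  have := Fintype.ofFinite Λ.openIn
  have hdual : ∀ e : Γ.Edge, ∃ (z : 𝒱 e) (ψ : Module.Dual ℂ (𝒱 e)), ψ z = 1 := fun e => by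
    obtain ⟨z, hz⟩ := exists_ne (0 : 𝒱 e)
    exact ⟨z, Module.Projective.exists_dual_eq_one ℂ hz⟩
  choose z ψ hψ using hdual
  obtain ⟨η, hη⟩ := TensorProduct.exists_dual_tprod_tmul
    (fun e : Λ.openOut => Module.Dual.eval ℂ (𝒱 e) (z e)) (fun e : Λ.openIn => ψ e)
  have h1 := hη (fun e => ψ e) (fun e => z e)
  have h2 : A.blockedTensor Λ (PiTensorProduct.tprod ℂ (fun e : Λ.openOut => ψ e) ⊗ₜ[ℂ]
      PiTensorProduct.tprod ℂ (fun e : Λ.openIn => z e)) = 0 := by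
    rw [blockedTensor_tprod]
    refine Finset.sum_eq_zero fun i _ => ?_
    exact MultilinearMap.map_coord_zero _ ⟨v, hv⟩ (hzero fun e => (_, _))
  rw [hΛ (h2.trans (map_zero _).symm), map_zero] at h1
  simp [hψ] at h1

variable [Fintype Γ.Edge] [DecidableEq Γ.Edge]

/-- Since the two endpoints of an edge have disjoint injective neighborhoods, every edge can be cut
by removing an injective region that avoids `v`. -/
theorem IsBigEnough.vanishesCut_univ [Finite V] [∀ e, Nontrivial (𝒱 e)] {A B : PEPS Γ 𝒱 H}
    (hA : A.IsBigEnough) {v : V} (hAB : ∀ w, w ≠ v → B w = A w) (hB : B.VanishesCut ∅) :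
    B.VanishesCut Set.univ := by
  have hregion : ∀ e : Γ.Edge, ∃ Λ : Γ.Subgraph, B.IsInjectiveRegion Λ ∧ e ∈ Λ.touching := by
    intro e
    obtain ⟨Λo, Λt, hdisj, ho, ht, hio, hit⟩ := hA e
    by_cases hv : v ∈ Λo.verts
    · refine ⟨Λt, hit.congr fun w hw => hAB w ?_, Or.inr ht⟩
      rintro rfl
      exact Set.disjoint_left.1 hdisj hv hw
    · refine ⟨Λo, hio.congr fun w hw => hAB w ?_, Or.inl ho⟩
      rintro rfl
      exact hv hw
  have hfin : ∀ s : Finset Γ.Edge, B.VanishesCut (s : Set Γ.Edge) := by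
    intro s
    induction s using Finset.induction_on with
    | empty => simpa using hB
    | insert e s _ ih =>
      obtain ⟨Λ, hΛ, he⟩ := hregion e
      refine (ih.union_touching hΛ).anti ?_
      rw [Finset.coe_insert]
      exact Set.insert_subset (Or.inr he) Set.subset_union_left
  simpa using hfin Finset.univ

/-- Once all edges are cut, the legs at different vertices are independent. -/
theorem VanishesCut.evalLegs_eq_zero [Finite V] [∀ e, Nontrivial (𝒱 e)] {B : PEPS Γ 𝒱 H}
    (hB : B.VanishesCut Set.univ) {v : V} (hne : ∀ w, w ≠ v → ∃ n, B.evalLegs n w ≠ 0)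
    (n : ∀ e, Module.Dual ℂ (𝒱 e) × 𝒱 e) : B.evalLegs n v = 0 := by
  classical
  by_contra hv
  have hall : ∀ w, ∃ n, B.evalLegs n w ≠ 0 := fun w => by
    by_cases hw : w = v
    · subst hw
      exact ⟨n, hv⟩
    · exact hne w hw
  choose m hm using hall
  -- Each edge takes its functional from its origin and its vector from its terminus.
  have h := hB (fun e _ => ((m e.origin e).1, (m e.terminus e).2))
    fun e he => absurd (Set.mem_univ e) he
  rw [contract, Finset.sum_const, ← Nat.cast_smul_eq_nsmul ℂ, smul_eq_zero] at h
  rcases h with h | h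
  · rw [Finset.card_univ] at h
    exact Fintype.card_ne_zero (by exact_mod_cast h)
  · refine PiTensorProduct.tprod_ne_zero (fun w => ?_) h
    rw [B.evalLegs_congr (n' := m w)]
    · exact hm w
    · rintro e rfl
      rfl
    · rintro e rfl
      rfl

theorem state_eq_contract [Finite V] (A : PEPS Γ 𝒱 H) : A.state = A.contract (basisLegs 𝒱) := by
  unfold state contract
  congr!

end PEPS

end

theorem mainTheorem5 {V : Type*} [Finite V] (Γ : OrientedGraph V)
    (𝒱 : Γ.Edge → Type*) [∀ e, AddCommGroup (𝒱 e)] [∀ e, Module ℂ (𝒱 e)]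
    [∀ e, FiniteDimensional ℂ (𝒱 e)] [∀ e, Nontrivial (𝒱 e)]
    (H : V → Type*) [∀ v, AddCommGroup (H v)] [∀ v, Module ℂ (H v)]
    (A : PEPS Γ 𝒱 H) (hnormal : A.IsNormal) (hbig : A.IsBigEnough)
    {G : Type*} [Group G] (U : ∀ v, Representation ℂ G (H v)) (hsymm : A.IsLocallySymmetric U) :
    ∀ (g : G) (v : V), U v g ∘ₗ A v = A v := by
  intro g v
  classical
  let : Fintype Γ.Edge := Fintype.ofFinite _
  let : DecidableEq Γ.Edge := Classical.decEq _
  let B : PEPS Γ 𝒱 H := Function.update A v ((U v g - LinearMap.id) ∘ₗ A v)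
  have hAB : ∀ w, w ≠ v → B w = A w := fun w hw => Function.update_of_ne hw _ _
  have hB : B.VanishesCut ∅ := by
    intro p hp
    obtain rfl : p = PEPS.basisLegs 𝒱 := funext fun e => hp e (Set.notMem_empty e)
    have h1 := A.contract_update_comp v (U v g) (PEPS.basisLegs 𝒱)
    have h2 := hsymm g v
    rw [PEPS.state_eq_contract] at h2
    exact add_eq_right.1 (h1.trans h2)
  have hne : ∀ w, w ≠ v → ∃ n, B.evalLegs n w ≠ 0 := fun w hw => by
    obtain ⟨Λ, hΛ, hi⟩ := hnormal w
    obtain ⟨n, hn⟩ := hi.exists_evalLegs_ne_zero hΛ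
    refine ⟨n, ?_⟩
    rwa [PEPS.evalLegs, PEPS.eval, hAB w hw]
  have hzero := (hbig.vanishesCut_univ hAB hB).evalLegs_eq_zero hne
  apply TensorProduct.ext
  ext φ x
  have := hzero fun e => (if h : e ∈ Γ.outEdges v then φ ⟨e, h⟩ else 0,
    if h : e ∈ Γ.inEdges v then x ⟨e, h⟩ else 0)
  simpa [PEPS.evalLegs, PEPS.eval, B, sub_eq_zero] using this
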